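/- Let $\mathcal{C}at$ be the category of small categories and $e$ the category with one object and one (identity) morphism. For a functor $u:A\to B$ and an object $b$ of $B$, $A/b$ (resp. $b\backslash A$) denotes the category of pairs $(a,\,p:u(a)\to b)$ (resp. $(a,\,p:b\to u(a))$), and $A_b$ the fibre of $u$ at $b$ (objects $a$ of $A$ with $u(a)=b$, morphisms $f$ of $A$ with $u(f)=\mathrm{id}_b$). Let $\mathcal{W}$ be a weak fundamental localizer, i.e. a class of arrows of $\mathcal{C}at$ such that: $\mathcal W$ contains the identities; if two of the three arrows of a commutative triangle are in $\mathcal W$, so is the third; if $ri=\mathrm{id}$ and $ir\in\mathcal W$, then $r\in\mathcal W$; if $A$ has a terminal object, then $A\to e$ is in $\mathcal W$; and if $u:A\to B$ is a functor such that for every object $b$ of $B$ the induced functor $A/b\to B/b$ is in $\mathcal W$, then $u\in\mathcal W$. A functor $u:A\to B$ between small categories is $\mathcal W$-aspherical (resp. $\mathcal W$-coaspherical) if for every object $b$ of $B$ the induced functor $A/b\to B/b$ (resp. $b\backslash A\to b\backslash B$) is in $\mathcal W$. It is $\mathcal W$-smooth (resp. $\mathcal W$-proper) if for every object $b$ of $B$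 the canonical functor $A_b\to b\backslash A$ (resp. $A_b\to A/b$), $a\mapsto(a,\mathrm{id}_b)$, is $\mathcal W$-aspherical (resp. $\mathcal W$-coaspherical). A square consists of functors between small categories $v:A'\to A$, $u':A'\to B'$, $u:A\to B$, $w:B'\to B$ and a natural transformation $\alpha:uv\to wu'$. It is cartesian if $uv=wu'$, $\alpha$ is the identity, and the induced functor $A'\to B'\times_B A$ is an isomorphism of categories. It is $\mathcal W$-exact if for every object $b'$ of $B'$ the functor $A'/b'\to A/w(b')$, $(a',g')\mapsto(v(a'),\,w(g')\alpha_{a'})$, is $\mathcal W$-coaspherical. Then: (1) For every cartesian square as above, if $u$ is $\mathcal W$-proper or $w$ is $\mathcal W$-smooth, then the square is $\mathcal W$-exact. (2) A functor $u:A\to B$ between small categories is $\mathcal W$-proper if and only if every cartesian square as above with this $u$ as right vertical arrow ($A'$, $B'$, $v$, $u'$, $w$ being arbitrary) is $\mathcal W$-exact. -/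

import Mathlib

open CategoryTheory

universe s

namespace FundLoc

/-- Membership in a class `W` of arrows of `Cat` for a functor between small categories. -/
abbrev WEquiv (W : MorphismProperty Cat.{s, s}) {A B : Type s} [SmallCategory A]
    [SmallCategory B] (u : A ⥤ B) : Prop :=
  W u.toCatHom

/-- The functor `A ⟶ e` to the point category. -/
abbrev toPoint (A : Type s) [SmallCategory A] : A ⥤ Discrete PUnit.{s + 1} :=
  (Functor.const A).obj ⟨PUnit.unit⟩

/-- Weakly saturated classes of arrows of `Cat`: they contain the identities, satisfy
two-out-of-three, and if `i ≫ r` is an identity and `r ≫ i` is in the class, then so is `r`. -/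
structure IsWeaklySaturated (W : MorphismProperty Cat.{s, s}) : Prop where
  id_mem : ∀ A : Cat.{s, s}, W (𝟙 A)
  two_out_of_three : W.HasTwoOutOfThreeProperty
  of_retraction : ∀ {A' A : Cat.{s, s}} (i : A' ⟶ A) (r : A ⟶ A'),
    i ≫ r = 𝟙 A' → W (r ≫ i) → W r

/-- `u` is `W`-aspherical if for every object `b` of the target the functor `A/b ⥤ B/b`
induced by `u` is in `W`. -/
def IsAspherical (W : MorphismProperty Cat.{s, s}) {A B : Type s} [SmallCategory A]
    [SmallCategory B] (u : A ⥤ B) : Prop :=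
  ∀ b : B, WEquiv W (CostructuredArrow.toOver u b)

/-- `u` is `W`-coaspherical if for every object `b` of the target the functor `b\A ⥤ b\B`
induced by `u` is in `W`. -/
def IsCoaspherical (W : MorphismProperty Cat.{s, s}) {A B : Type s} [SmallCategory A]
    [SmallCategory B] (u : A ⥤ B) : Prop :=
  ∀ b : B, WEquiv W (StructuredArrow.toUnder b u)

/-- Weak fundamental localizers. The last field is the non-relative form of Quillen's
theorem A: a functor `u : A ⥤ B` such that all the induced functors `A/b ⥤ B/b` are in `W`
is itself in `W`. -/
structure IsWeakFundamentalLocalizer (W : MorphismProperty Cat.{s, s}) : Prop where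
  weaklySaturated : IsWeaklySaturated W
  of_hasTerminal : ∀ (A : Type s) [SmallCategory A], Limits.HasTerminal A →
    WEquiv W (toPoint A)
  of_isAspherical : ∀ {A B : Type s} [SmallCategory A] [SmallCategory B] (u : A ⥤ B),
    IsAspherical W u → WEquiv W u

section Fiber

variable {A B : Type s} [SmallCategory A] [SmallCategory B]

lemma map_fiber_hom (u : A ⥤ B) (b : B) {x y : u.Fiber b} (φ : x ⟶ y) :
    u.map φ.1 = eqToHom (x.2.trans y.2.symm) := by
  have := φ.2
  simpa using IsHomLift.fac' u (𝟙 b) φ.1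

/-- The canonical functor from the fibre `A_b` to `b\A`, sending `a` to
`(a, id : b ⟶ u(a))`. -/
def fiberToUnder (u : A ⥤ B) (b : B) : u.Fiber b ⥤ StructuredArrow b u where
  obj a := StructuredArrow.mk (Y := a.1) (eqToHom a.2.symm)
  map {x y} φ := StructuredArrow.homMk φ.1 (by
    rw [StructuredArrow.mk_hom_eq_self, map_fiber_hom]
    exact eqToHom_trans _ _)
  map_id _ := rfl
  map_comp _ _ := rfl

/-- The canonical functor from the fibre `A_b` to `A/b`, sending `a` to
`(a, id : u(a) ⟶ b)`. -/
def fiberToOver (u : A ⥤ B) (b : B) : u.Fiber b ⥤ CostructuredArrow u b where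
  obj a := CostructuredArrow.mk (Y := a.1) (eqToHom a.2)
  map {x y} φ := CostructuredArrow.homMk φ.1 (by
    rw [CostructuredArrow.mk_hom_eq_self, map_fiber_hom]
    exact eqToHom_trans _ _)
  map_id _ := rfl
  map_comp _ _ := rfl

/-- `u` is `W`-smooth if all the canonical functors `A_b ⥤ b\A` are `W`-aspherical. -/
def IsSmooth (W : MorphismProperty Cat.{s, s}) (u : A ⥤ B) : Prop :=
  ∀ b : B, IsAspherical W (fiberToUnder u b)

/-- `u` is `W`-proper if all the canonical functors `A_b ⥤ A/b` are `W`-coaspherical. -/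
def IsProper (W : MorphismProperty Cat.{s, s}) (u : A ⥤ B) : Prop :=
  ∀ b : B, IsCoaspherical W (fiberToOver u b)

end Fiber

section Square

variable {A' A B' B : Type s} [SmallCategory A'] [SmallCategory A] [SmallCategory B']
  [SmallCategory B] {v : A' ⥤ A} {u' : A' ⥤ B'} {u : A ⥤ B} {w : B' ⥤ B}

/-- A 2-square `α : v ⋙ u ⟶ u' ⋙ w` is cartesian if it is commutative (`v ⋙ u = u' ⋙ w`
and `α` is the identity) and if it is a (strict) pullback square in `Cat`. -/
structure IsCartesian (α : TwoSquare v u' u w) : Prop where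
  comm : ∃ h : v ⋙ u = u' ⋙ w, α.natTrans = eqToHom h
  isPullback : IsPullback v.toCatHom u'.toCatHom u.toCatHom w.toCatHom

/-- A 2-square is `W`-exact if for every object `b'` of `B'` the functor
`A'/b' ⥤ A/w(b')` induced by `v` and `α`, sending `(a', g')` to
`(v(a'), w(g') ∘ α_{a'})`, is `W`-coaspherical. -/
def IsExact (W : MorphismProperty Cat.{s, s}) (α : TwoSquare v u' u w) : Prop :=
  ∀ b' : B', IsCoaspherical W (α.costructuredArrowRightwards b')

end Square

end FundLoc

/-! Asphericity and coasphericity of a functor depend only on which comma categories are aspherical.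
Two facts about them drive the proof.

Cancellation: if `p` and `p ⋙ q` are (co)aspherical, so is `q`. The aspherical case rests on the
given theorem A. The coaspherical case needs a dual statement that is not an axiom: the source of a
coaspherical functor is aspherical iff its target is. It is obtained by comparing both with a
category of arrows `b ⟶ u(a)` (`asphericalCat_iff_of_isCoaspherical`).

Base change: in a strict pullback the fibres `A'_b` and `A_{w(b)}` agree, as do the comma categories
testing properness, so properness passes from `u` to `u'`. The functors from these fibres to `A'/b`
and to `A/w(b)` are then coaspherical, and cancellation makes `A'/b ⥤ A/w(b)` coaspherical.

Exactness can equally be tested by asphericity of the functors `a\A' ⥤ u(a)\B'` (`isExact_iff`), so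
the mirror argument handles smooth `w`. Conversely, exactness of the pullback along a point `b` of
`B` says precisely that `A_b ⥤ A/b` is coaspherical. -/

namespace FundLoc

/-! ### Aspherical categories and tests by comma categories -/

section Localizer

variable {W : MorphismProperty Cat.{s, s}} {A B C : Type s} [SmallCategory A] [SmallCategory B]
  [SmallCategory C]

/-- A small category `A` is `W`-aspherical if the functor from `A` to the point is in `W`. -/
abbrev AsphericalCat (W : MorphismProperty Cat.{s, s}) (A : Type s) [SmallCategory A] : Prop :=
  WEquiv W (toPoint A)

namespace IsWeakFundamentalLocalizer

lemma asphericalCat_iff_of_wEquiv (hW : IsWeakFundamentalLocalizer W) {u : A ⥤ B} (hu : WEquiv W u) :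
    AsphericalCat W A ↔ AsphericalCat W B := by
  have := hW.weaklySaturated.two_out_of_three
  have e : (toPoint A).toCatHom = u.toCatHom ≫ (toPoint B).toCatHom := rfl
  unfold AsphericalCat WEquiv
  rw [e]
  exact W.precomp_iff _ _ hu |>.trans Iff.rfl

lemma wEquiv_of_asphericalCat (hW : IsWeakFundamentalLocalizer W) (u : A ⥤ B) (hA : AsphericalCat W A) (hB : AsphericalCat W B) :
    WEquiv W u := by
  have := hW.weaklySaturated.two_out_of_three
  have e : (toPoint A).toCatHom = u.toCatHom ≫ (toPoint B).toCatHom := rfl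
  unfold AsphericalCat WEquiv at hA
  rw [e] at hA
  exact W.of_postcomp _ _ hB hA

lemma isAspherical_iff (hW : IsWeakFundamentalLocalizer W) (u : A ⥤ B) :
    IsAspherical W u ↔ ∀ b, AsphericalCat W (CostructuredArrow u b) := by
  refine forall_congr' fun b => ?_
  have hb : AsphericalCat W (Over b) := hW.of_hasTerminal _ inferInstance
  exact ⟨fun h => (hW.asphericalCat_iff_of_wEquiv h).2 hb,
    fun h => hW.wEquiv_of_asphericalCat _ h hb⟩

lemma isAspherical_of_isLeftAdjoint (hW : IsWeakFundamentalLocalizer W) (u : A ⥤ B) [u.IsLeftAdjoint] : IsAspherical W u :=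
  (hW.isAspherical_iff u).2 fun b => hW.of_hasTerminal _
    (isLeftAdjoint_iff_hasTerminal_costructuredArrow.1 inferInstance b)

lemma asphericalCat_iff_of_equivalence (hW : IsWeakFundamentalLocalizer W) (e : A ≌ B) : AsphericalCat W A ↔ AsphericalCat W B :=
  hW.asphericalCat_iff_of_wEquiv
    (hW.of_isAspherical _ (hW.isAspherical_of_isLeftAdjoint e.functor))

lemma asphericalCat_iff_of_isLeftAdjoint (hW : IsWeakFundamentalLocalizer W) (u : A ⥤ B) [u.IsLeftAdjoint] :
    AsphericalCat W A ↔ AsphericalCat W B :=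
  hW.asphericalCat_iff_of_wEquiv (hW.of_isAspherical _ (hW.isAspherical_of_isLeftAdjoint u))

lemma asphericalCat_of_hasInitial (hW : IsWeakFundamentalLocalizer W) (A : Type s)
    [SmallCategory A] [Limits.HasInitial A] : AsphericalCat W A := by
  -- An initial object is a left adjoint to the functor to the point, and left adjoints are
  -- aspherical.
  let pt : Discrete PUnit.{s + 1} ⥤ A := (Functor.const _).obj (⊥_ A)
  let adj : pt ⊣ toPoint A :=
    Adjunction.mkOfHomEquiv
      { homEquiv := fun X Y =>
          { toFun := fun _ => eqToHom (Subsingleton.elim _ _)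
            invFun := fun _ => Limits.initial.to Y
            left_inv := fun _ => Limits.initialIsInitial.hom_ext _ _
            right_inv := fun _ => Subsingleton.elim _ _ }
        homEquiv_naturality_left_symm := fun _ _ => Limits.initialIsInitial.hom_ext _ _
        homEquiv_naturality_right := fun _ _ => Subsingleton.elim _ _ }
  have : pt.IsLeftAdjoint := ⟨_, ⟨adj⟩⟩
  exact (hW.asphericalCat_iff_of_isLeftAdjoint pt).1 (hW.weaklySaturated.id_mem _)

lemma isCoaspherical_iff (hW : IsWeakFundamentalLocalizer W) (u : A ⥤ B) :
    IsCoaspherical W u ↔ ∀ b, AsphericalCat W (StructuredArrow b u) := by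
  refine forall_congr' fun b => ?_
  have hb : AsphericalCat W (Under b) := hW.asphericalCat_of_hasInitial _
  exact ⟨fun h => (hW.asphericalCat_iff_of_wEquiv h).2 hb,
    fun h => hW.wEquiv_of_asphericalCat _ h hb⟩

end IsWeakFundamentalLocalizer

/-! ### The category of arrows `b ⟶ u(a)` and its two projections -/

/-- The category of arrows `b ⟶ u(a)`, contravariant in `b` and covariant in `a`; for
`u = 𝟭` this is the twisted arrow category. -/
structure TwistedComma (u : A ⥤ B) where
  /-- The source of the arrow. -/
  left : B
  /-- The object over the target of the arrow. -/
  right : A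
  /-- The arrow. -/
  hom : left ⟶ u.obj right

namespace TwistedComma

variable {u : A ⥤ B}

/-- Morphisms of `TwistedComma u`. -/
@[ext]
structure Hom (X Y : TwistedComma u) where
  /-- The component between the sources. -/
  left : Y.left ⟶ X.left
  /-- The component between the targets. -/
  right : X.right ⟶ Y.right
  w : left ≫ X.hom ≫ u.map right = Y.hom := by cat_disch

instance : SmallCategory (TwistedComma u) where
  Hom := Hom
  id X := { left := 𝟙 _, right := 𝟙 _ }
  comp f g :=
    { left := g.left ≫ f.left
      right := f.right ≫ g.right
      w := by rw [← g.w, ← f.w]; simp }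
  id_comp f := Hom.ext (Category.comp_id _) (Category.id_comp _)
  comp_id f := Hom.ext (Category.id_comp _) (Category.comp_id _)
  assoc f g h := Hom.ext (Category.assoc _ _ _).symm (Category.assoc _ _ _)

@[ext]
lemma hom_ext {X Y : TwistedComma u} {f g : X ⟶ Y} (hl : f.left = g.left)
    (hr : f.right = g.right) : f = g :=
  Hom.ext hl hr

variable (u)

/-- The projection to the opposite of the category of sources. -/
@[simps]
def source : TwistedComma u ⥤ Bᵒᵖ where
  obj X := .op X.left
  map f := f.left.op

/-- The projection to the category of targets. -/
@[simps]
def target : TwistedComma u ⥤ A where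
  obj X := X.right
  map f := f.right

/-- The reflection of `source u / b` onto the fibre `b \ A`. -/
@[simps]
def sourceReflection (b : Bᵒᵖ) : CostructuredArrow (source u) b ⥤ StructuredArrow b.unop u where
  obj X := StructuredArrow.mk (X.hom.unop ≫ X.left.hom)
  map {X Y} f := StructuredArrow.homMk f.left.right (by
    have h : Y.hom.unop ≫ f.left.left = X.hom.unop :=
      congrArg Quiver.Hom.unop (CostructuredArrow.w f)
    have h' := f.left.w
    rw [← h, ← h']
    exact (Category.assoc _ _ _).trans (Category.assoc _ _ _))

/-- The right adjoint regards an arrow `b ⟶ u(a)` as an object whose source is `b` itself, with the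
identity as structure map. -/
instance (b : Bᵒᵖ) : (sourceReflection u b).IsLeftAdjoint := by
  refine isLeftAdjoint_iff_hasTerminal_costructuredArrow.2 fun Y => ?_
  let X₀ : CostructuredArrow (source u) b :=
    CostructuredArrow.mk (Y := TwistedComma.mk b.unop Y.right Y.hom) (𝟙 b :)
  let T : CostructuredArrow (sourceReflection u b) Y := CostructuredArrow.mk (Y := X₀) (StructuredArrow.homMk (𝟙 Y.right)
      ((congrArg (_ ≫ ·) (u.map_id _)).trans ((Category.comp_id _).trans (Category.id_comp _))))
  refine Limits.IsTerminal.hasTerminal (X := T) (Limits.IsTerminal.ofUniqueHom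
    (fun X => CostructuredArrow.homMk (CostructuredArrow.homMk
      { left := X.left.hom.unop, right := X.hom.right, w := ?_ } ?_) ?_) fun X m => ?_)
  · exact (Category.assoc _ _ _).symm.trans (StructuredArrow.w X.hom)
  · exact Category.comp_id _
  · exact StructuredArrow.hom_ext _ _ (Category.comp_id _)
  · have hl : m.left.left.left.op ≫ 𝟙 b = X.left.hom := CostructuredArrow.w m.left
    have hr : m.left.left.right ≫ 𝟙 Y.right = X.hom.right :=
      congrArg StructuredArrow.Hom.right (CostructuredArrow.w m)
    refine CostructuredArrow.hom_ext _ _ (CostructuredArrow.hom_ext _ _ (hom_ext ?_ ?_))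
    · exact congrArg Quiver.Hom.unop ((Category.comp_id _).symm.trans hl)
    · exact (Category.comp_id _).symm.trans hr

/-- The reflection of `target u / a` onto the fibre `(B / u(a))ᵒᵖ`. -/
@[simps]
def targetReflection (a : A) : CostructuredArrow (target u) a ⥤ (Over (u.obj a))ᵒᵖ where
  obj X := .op (Over.mk (X.left.hom ≫ u.map X.hom))
  map {X Y} f := .op (Over.homMk f.left.left (by
    have h : f.left.right ≫ Y.hom = X.hom := CostructuredArrow.w f
    have h' := f.left.w
    rw [← h, ← h']
    simp only [Over.mk_left, Over.mk_hom, Category.assoc]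
    exact congrArg (f.left.left ≫ X.left.hom ≫ ·) (u.map_comp _ _)))

/-- The right adjoint regards an arrow `c ⟶ u(a)` as an object lying over `a` by the identity. -/
instance (a : A) : (targetReflection u a).IsLeftAdjoint := by
  refine isLeftAdjoint_iff_hasTerminal_costructuredArrow.2 fun Y => ?_
  let X₀ : CostructuredArrow (target u) a :=
    CostructuredArrow.mk (Y := TwistedComma.mk Y.unop.left a Y.unop.hom) (𝟙 a :)
  let T : CostructuredArrow (targetReflection u a) Y := CostructuredArrow.mk (Y := X₀) (.op (Over.homMk (𝟙 _)
      ((Category.id_comp _).trans ((congrArg (_ ≫ ·) (u.map_id a)).trans (Category.comp_id _)))))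
  refine Limits.IsTerminal.hasTerminal (X := T) (Limits.IsTerminal.ofUniqueHom
    (fun X => CostructuredArrow.homMk (CostructuredArrow.homMk
      { left := X.hom.unop.left, right := X.left.hom, w := ?_ } ?_) ?_) fun X m => ?_)
  · exact Over.w X.hom.unop
  · exact Category.comp_id _
  · exact Quiver.Hom.unop_inj (Over.OverMorphism.ext (Category.id_comp _))
  · have hl : 𝟙 _ ≫ m.left.left.left = X.hom.unop.left :=
      congrArg (fun f => f.unop.left) (CostructuredArrow.w m)
    have hr : m.left.left.right ≫ 𝟙 a = X.left.hom := CostructuredArrow.w m.left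
    refine CostructuredArrow.hom_ext _ _ (CostructuredArrow.hom_ext _ _ (hom_ext ?_ ?_))
    · exact (Category.id_comp _).symm.trans hl
    · exact (Category.comp_id _).symm.trans hr

end TwistedComma

/-! ### Theorem A for coaspherical functors, and cancellation -/

namespace IsWeakFundamentalLocalizer

/-- Both projections of `TwistedComma u` are aspherical: up to a left adjoint, their slices are the
`b\A`, aspherical by hypothesis, and the `(B/u(a))ᵒᵖ`, which have an initial object. -/
lemma asphericalCat_op_iff_of_isCoaspherical (hW : IsWeakFundamentalLocalizer W) {u : A ⥤ B}
    (hu : IsCoaspherical W u) : AsphericalCat W A ↔ AsphericalCat W Bᵒᵖ := by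
  have hs : IsAspherical W (TwistedComma.source u) := (hW.isAspherical_iff _).2 fun b =>
    (hW.asphericalCat_iff_of_isLeftAdjoint (TwistedComma.sourceReflection u b)).2
      ((hW.isCoaspherical_iff u).1 hu _)
  have ht : IsAspherical W (TwistedComma.target u) := (hW.isAspherical_iff _).2 fun a =>
    (hW.asphericalCat_iff_of_isLeftAdjoint (TwistedComma.targetReflection u a)).2
      (hW.asphericalCat_of_hasInitial _)
  rw [← hW.asphericalCat_iff_of_wEquiv (hW.of_isAspherical _ hs),
    hW.asphericalCat_iff_of_wEquiv (hW.of_isAspherical _ ht)]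

lemma isCoaspherical_id (hW : IsWeakFundamentalLocalizer W) (A : Type s) [SmallCategory A] :
    IsCoaspherical W (𝟭 A) :=
  (hW.isCoaspherical_iff _).2 fun b => hW.asphericalCat_of_hasInitial (Under b)

lemma asphericalCat_iff_of_isCoaspherical (hW : IsWeakFundamentalLocalizer W) {u : A ⥤ B}
    (hu : IsCoaspherical W u) : AsphericalCat W A ↔ AsphericalCat W B := by
  -- The case of the identity of `B` removes the `op`.
  rw [hW.asphericalCat_op_iff_of_isCoaspherical hu,
    hW.asphericalCat_op_iff_of_isCoaspherical (hW.isCoaspherical_id B)]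

lemma isCoaspherical_of_comp (hW : IsWeakFundamentalLocalizer W) {p : A ⥤ B} {q : B ⥤ C}
    (hp : IsCoaspherical W p) (hpq : IsCoaspherical W (p ⋙ q)) : IsCoaspherical W q := by
  rw [hW.isCoaspherical_iff] at *
  intro c
  -- The comma categories of the induced functor between the categories under `c` are those of `p`.
  have h : IsCoaspherical W (StructuredArrow.pre c p q) := (hW.isCoaspherical_iff _).2 fun f =>
    (hW.asphericalCat_iff_of_equivalence (StructuredArrow.preEquivalence p f)).2 (hp _)
  exact (hW.asphericalCat_iff_of_isCoaspherical h).1 (hpq c)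

lemma isAspherical_of_comp (hW : IsWeakFundamentalLocalizer W) {p : A ⥤ B} {q : B ⥤ C}
    (hp : IsAspherical W p) (hpq : IsAspherical W (p ⋙ q)) : IsAspherical W q := by
  rw [hW.isAspherical_iff] at *
  intro c
  have h : IsAspherical W (CostructuredArrow.pre p q c) := (hW.isAspherical_iff _).2 fun f =>
    (hW.asphericalCat_iff_of_equivalence (CostructuredArrow.preEquivalence p f)).2 (hp _)
  exact (hW.asphericalCat_iff_of_wEquiv (hW.of_isAspherical _ h)).1 (hpq c)

lemma isCoaspherical_equivalence_comp (hW : IsWeakFundamentalLocalizer W) (e : A ⥤ B)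
    [e.IsEquivalence] {q : B ⥤ C} (hq : IsCoaspherical W q) : IsCoaspherical W (e ⋙ q) := by
  rw [hW.isCoaspherical_iff] at *
  exact fun c => (hW.asphericalCat_iff_of_equivalence
    (StructuredArrow.pre c e q).asEquivalence).2 (hq c)

lemma isAspherical_equivalence_comp (hW : IsWeakFundamentalLocalizer W) (e : A ⥤ B)
    [e.IsEquivalence] {q : B ⥤ C} (hq : IsAspherical W q) : IsAspherical W (e ⋙ q) := by
  rw [hW.isAspherical_iff] at *
  exact fun c => (hW.asphericalCat_iff_of_equivalence
    (CostructuredArrow.pre e q c).asEquivalence).2 (hq c)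

lemma isCoaspherical_of_iso (hW : IsWeakFundamentalLocalizer W) {p q : A ⥤ B} (i : p ≅ q)
    (hp : IsCoaspherical W p) : IsCoaspherical W q := by
  rw [hW.isCoaspherical_iff] at *
  exact fun c => (hW.asphericalCat_iff_of_equivalence (Comma.mapRightIso _ i)).1 (hp c)

lemma isAspherical_of_iso (hW : IsWeakFundamentalLocalizer W) {p q : A ⥤ B} (i : p ≅ q)
    (hp : IsAspherical W p) : IsAspherical W q := by
  rw [hW.isAspherical_iff] at *
  exact fun c => (hW.asphericalCat_iff_of_equivalence (Comma.mapLeftIso _ i)).1 (hp c)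

end IsWeakFundamentalLocalizer

end Localizer

/-! ### Strict pullbacks of categories, elementwise -/

section StrictPullback

variable {A' A B' B : Type s} [SmallCategory A'] [SmallCategory A] [SmallCategory B']
  [SmallCategory B] {v : A' ⥤ A} {u' : A' ⥤ B'} {u : A ⥤ B} {w : B' ⥤ B}

lemma eqToHom_conj_cancel {C : Type*} [Category* C] {X Y X' Y' : C} {p : X' = X} {q : Y = Y'}
    {p' : X = X'} {q' : Y' = Y} {f : X ⟶ Y} {g : X' ⟶ Y'}
    (h : g = eqToHom p ≫ f ≫ eqToHom q) : eqToHom p' ≫ g ≫ eqToHom q' = f := by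
  subst p q
  simp [h]

/-- The strict pullback of two functors. -/
structure StrictPullback (u : A ⥤ B) (w : B' ⥤ B) where
  /-- The first component. -/
  fst : A
  /-- The second component. -/
  snd : B'
  eq : u.obj fst = w.obj snd

namespace StrictPullback

/-- Morphisms in the strict pullback of two functors. -/
@[ext]
structure Hom (X Y : StrictPullback u w) where
  /-- The first component. -/
  fst : X.fst ⟶ Y.fst
  /-- The second component. -/
  snd : X.snd ⟶ Y.snd
  eq : u.map fst ≫ eqToHom Y.eq = eqToHom X.eq ≫ w.map snd

instance : SmallCategory (StrictPullback u w) where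
  Hom := Hom
  id X := { fst := 𝟙 _, snd := 𝟙 _, eq := by simp }
  comp f g :=
    { fst := f.fst ≫ g.fst
      snd := f.snd ≫ g.snd
      eq := by rw [Functor.map_comp, Category.assoc, g.eq, reassoc_of% f.eq, Functor.map_comp] }
  id_comp f := Hom.ext (Category.id_comp _) (Category.id_comp _)
  comp_id f := Hom.ext (Category.comp_id _) (Category.comp_id _)
  assoc f g h := Hom.ext (Category.assoc _ _ _) (Category.assoc _ _ _)

variable (u w) in
/-- The first projection. -/
@[simps]
def fstFunctor : StrictPullback u w ⥤ A where
  obj X := X.fst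
  map f := f.fst

variable (u w) in
/-- The second projection. -/
@[simps]
def sndFunctor : StrictPullback u w ⥤ B' where
  obj X := X.snd
  map f := f.snd

lemma condition : fstFunctor u w ⋙ u = sndFunctor u w ⋙ w :=
  CategoryTheory.Functor.ext (fun X => X.eq) fun X Y f => by
    rw [← Category.assoc]
    exact (comp_eqToHom_iff _ _ _).1 f.eq

/-- The functor to the strict pullback induced by a commutative square. -/
@[simps]
def lift (h : v ⋙ u = u' ⋙ w) : A' ⥤ StrictPullback u w where
  obj a := ⟨v.obj a, u'.obj a, Functor.congr_obj h a⟩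
  map f := ⟨v.map f, u'.map f, by simpa using (eqToHom h).naturality f⟩
  map_id a := Hom.ext (v.map_id a) (u'.map_id a)
  map_comp f g := Hom.ext (v.map_comp f g) (u'.map_comp f g)

end StrictPullback

variable (v u' u w) in
/-- Elementwise form of the condition that a square of functors is a strict pullback. -/
structure IsStrictPullback : Prop where
  comm : v ⋙ u = u' ⋙ w
  exists_obj (x : A) (y : B') : u.obj x = w.obj y → ∃ a, v.obj a = x ∧ u'.obj a = y
  exists_map {a₁ a₂ : A'} (f : v.obj a₁ ⟶ v.obj a₂) (g : u'.obj a₁ ⟶ u'.obj a₂) :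
    u.map f ≫ eqToHom (Functor.congr_obj comm a₂) =
      eqToHom (Functor.congr_obj comm a₁) ≫ w.map g → ∃ φ, v.map φ = f ∧ u'.map φ = g
  hom_ext {a₁ a₂ : A'} {φ ψ : a₁ ⟶ a₂} : v.map φ = v.map ψ → u'.map φ = u'.map ψ → φ = ψ

lemma IsStrictPullback.symm (h : IsStrictPullback v u' u w) : IsStrictPullback u' v w u where
  comm := h.comm.symm
  exists_obj x y e := by
    obtain ⟨a, h₁, h₂⟩ := h.exists_obj y x e.symm
    exact ⟨a, h₂, h₁⟩
  exists_map f g e := by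
    obtain ⟨φ, h₁, h₂⟩ := h.exists_map g f (by
      rw [← cancel_mono (eqToHom (Functor.congr_obj h.comm.symm _)),
        ← cancel_epi (eqToHom (Functor.congr_obj h.comm.symm _))]
      simpa using e.symm)
    exact ⟨φ, h₂, h₁⟩
  hom_ext h₁ h₂ := h.hom_ext h₂ h₁

/-- The universal property is compared with the explicit model: `L` produces objects and arrows of
`A'`, and `K ⋙ L = 𝟭` gives joint faithfulness of `v` and `u'`. -/
lemma IsCartesian.isStrictPullback {α : TwoSquare v u' u w} (h : IsCartesian α) :
    IsStrictPullback v u' u w := by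
  obtain ⟨comm, -⟩ := h.comm
  let K : A' ⥤ StrictPullback u w := StrictPullback.lift comm
  obtain ⟨L, h₁, h₂⟩ : ∃ L : StrictPullback u w ⥤ A',
      L ⋙ v = StrictPullback.fstFunctor u w ∧ L ⋙ u' = StrictPullback.sndFunctor u w := by
    obtain ⟨L, h₁, h₂⟩ := h.isPullback.exists_lift
      (StrictPullback.fstFunctor u w).toCatHom (StrictPullback.sndFunctor u w).toCatHom
      (congrArg Functor.toCatHom StrictPullback.condition)
    exact ⟨L.toFunctor, congrArg (fun F => F.toFunctor) h₁, congrArg (fun F => F.toFunctor) h₂⟩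
  have hKL : K ⋙ L = 𝟭 A' := by
    have e : (K ⋙ L).toCatHom = 𝟙 (Cat.of A') := h.isPullback.hom_ext
      (congrArg (fun F => (K ⋙ F).toCatHom) h₁) (congrArg (fun F => (K ⋙ F).toCatHom) h₂)
    exact congrArg (fun F => F.toFunctor) e
  refine ⟨comm, fun x y e => ?_, fun {a₁ a₂} f g e => ?_, fun {a₁ a₂ φ ψ} e₁ e₂ => ?_⟩
  · exact ⟨L.obj ⟨x, y, e⟩, Functor.congr_obj h₁ _, Functor.congr_obj h₂ _⟩
  · let m : K.obj a₁ ⟶ K.obj a₂ := ⟨f, g, e⟩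
    refine ⟨eqToHom (Functor.congr_obj hKL a₁).symm ≫ L.map m ≫
      eqToHom (Functor.congr_obj hKL a₂), ?_, ?_⟩
    · rw [Functor.map_comp, Functor.map_comp, eqToHom_map, eqToHom_map]
      exact eqToHom_conj_cancel (Functor.congr_hom h₁ m)
    · rw [Functor.map_comp, Functor.map_comp, eqToHom_map, eqToHom_map]
      exact eqToHom_conj_cancel (Functor.congr_hom h₂ m)
  · have e : K.map φ = K.map ψ := StrictPullback.Hom.ext e₁ e₂
    have hφ := Functor.congr_hom hKL φ
    rw [Functor.comp_map, e] at hφ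
    exact (eqToHom_conj_cancel (p' := (Functor.congr_obj hKL a₁).symm)
      (q' := Functor.congr_obj hKL a₂) hφ).symm.trans
      (eqToHom_conj_cancel (Functor.congr_hom hKL ψ))

lemma IsCartesian.eq_eqToHom {α : TwoSquare v u' u w} (h : IsCartesian α) :
    α = TwoSquare.mk v u' u w (eqToHom h.isStrictPullback.comm) :=
  h.comm.choose_spec

/-- The functor between fibres induced by a commutative square. -/
@[simps]
def fiberMap (h : v ⋙ u = u' ⋙ w) (b : B') : u'.Fiber b ⥤ u.Fiber (w.obj b) where
  obj x := ⟨v.obj x.1, (Functor.congr_obj h x.1).trans (congrArg w.obj x.2)⟩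
  map {x y} φ := ⟨v.map φ.1, by
    refine IsHomLift.of_fac' _ _ _
      ((Functor.congr_obj h x.1).trans (congrArg w.obj x.2))
      ((Functor.congr_obj h y.1).trans (congrArg w.obj y.2)) ?_
    have := Functor.congr_hom h φ.1
    dsimp at this
    simp [this, map_fiber_hom, eqToHom_map]⟩
  map_id x := Subtype.ext (v.map_id _)
  map_comp f g := Subtype.ext (v.map_comp _ _)

lemma IsStrictPullback.isEquivalence_fiberMap (h : IsStrictPullback v u' u w) (b : B') :
    (fiberMap h.comm b).IsEquivalence where
  faithful := ⟨fun {x y φ ψ} e => Subtype.ext (h.hom_ext (congrArg Subtype.val e)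
    ((map_fiber_hom _ _ _).trans (map_fiber_hom _ _ _).symm))⟩
  full := ⟨fun {x y} f => by
    -- An arrow of a fibre lies over an identity, which forces its second component.
    obtain ⟨φ, h₁, h₂⟩ := h.exists_map f.1 (eqToHom (x.2.trans y.2.symm)) (by
      rw [eqToHom_map, eqToHom_trans]
      exact (congrArg (· ≫ eqToHom _) (map_fiber_hom u _ f)).trans (eqToHom_trans _ _))
    refine ⟨⟨φ, ?_⟩, Subtype.ext h₁⟩
    exact IsHomLift.of_fac' _ _ _ x.2 y.2 (by simp [h₂])⟩
  essSurj := ⟨fun ⟨x, hx⟩ => by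
    obtain ⟨a, rfl, h₂⟩ := h.exists_obj x b hx
    exact ⟨⟨a, h₂⟩, ⟨Iso.refl _⟩⟩⟩

end StrictPullback

/-! ### Base change of proper and smooth functors -/

section BaseChange

variable {W : MorphismProperty Cat.{s, s}}
variable {A' A B' B : Type s} [SmallCategory A'] [SmallCategory A] [SmallCategory B']
  [SmallCategory B] {v : A' ⥤ A} {u' : A' ⥤ B'} {u : A ⥤ B} {w : B' ⥤ B}

/-- Compatibility of the functors `fiberToOver` with the two vertical sides of a commutative
square. -/
def fiberToOverIso (h : v ⋙ u = u' ⋙ w) (b : B') :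
    fiberToOver u' b ⋙ (TwoSquare.mk v u' u w (eqToHom h)).costructuredArrowRightwards b ≅
      fiberMap h b ⋙ fiberToOver u (w.obj b) :=
  NatIso.ofComponents (fun x => CostructuredArrow.isoMk (Iso.refl _) (by
    have key : (eqToHom h).app x.1 ≫ w.map (eqToHom x.2) =
      eqToHom ((Functor.congr_obj h x.1).trans (congrArg w.obj x.2)) := by simp [eqToHom_map]
    exact (congrArg (· ≫ _) (u.map_id _)).trans ((Category.id_comp _).trans key.symm)))
    (fun f => CostructuredArrow.hom_ext _ _
      ((Category.comp_id _).trans (Category.id_comp _).symm))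

/-- Compatibility of the functors `fiberToUnder` with the two horizontal sides of a commutative
square. -/
def fiberToUnderIso (h : v ⋙ u = u' ⋙ w) (a : A) :
    fiberToUnder v a ⋙ (TwoSquare.mk v u' u w (eqToHom h)).structuredArrowDownwards a ≅
      fiberMap h.symm a ⋙ fiberToUnder w (u.obj a) :=
  NatIso.ofComponents (fun x => StructuredArrow.isoMk (Iso.refl _) (by
    have key : u.map (eqToHom x.2.symm) ≫ (eqToHom h).app x.1 =
      eqToHom ((congrArg u.obj x.2).symm.trans (Functor.congr_obj h x.1)) := by
        simp [eqToHom_map]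
    exact (congrArg (_ ≫ ·) (w.map_id _)).trans ((Category.comp_id _).trans key)))
    (fun f => StructuredArrow.hom_ext _ _
      ((Category.comp_id _).trans (Category.id_comp _).symm))

namespace IsStrictPullback

/-- The comparison, for a strict pullback square, of the categories of lifts along `u'` and `u`
of an arrow with given source. -/
abbrev liftsFunctor (h : v ⋙ u = u' ⋙ w) {b : B'} (Z : CostructuredArrow u' b) :
    StructuredArrow Z (fiberToOver u' b) ⥤
      StructuredArrow
        (((TwoSquare.mk v u' u w (eqToHom h)).costructuredArrowRightwards b).obj Z)
        (fiberToOver u (w.obj b)) :=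
  StructuredArrow.map₂ (𝟙 _) (fiberToOverIso h b).hom

lemma liftsFunctor_obj_hom_left (h : v ⋙ u = u' ⋙ w) {b : B'} {Z : CostructuredArrow u' b}
    (X : StructuredArrow Z (fiberToOver u' b)) :
    ((liftsFunctor h Z).obj X).hom.left = v.map X.hom.left :=
  (Category.id_comp _).trans (Category.comp_id _)

/-- A lift in `A` of the image of `Z.hom`, ending in the fibre over `w(b)`, forms with `Z.hom` a
compatible pair, hence comes from a unique arrow of `A'`. -/
lemma isEquivalence_liftsFunctor (h : IsStrictPullback v u' u w) {b : B'}
    (Z : CostructuredArrow u' b) : (liftsFunctor h.comm Z).IsEquivalence where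
  faithful := by
    have := h.isEquivalence_fiberMap b
    infer_instance
  full := ⟨fun {X Y} m => by
    have := h.isEquivalence_fiberMap b
    obtain ⟨φ, hφ⟩ := (fiberMap h.comm b).map_surjective m.right
    refine ⟨StructuredArrow.homMk φ ?_, StructuredArrow.hom_ext _ _ hφ⟩
    refine CostructuredArrow.hom_ext _ _ (h.hom_ext ?_ ?_)
    · have hv : v.map φ.1 = m.right.1 := congrArg Subtype.val hφ
      have hm : v.map X.hom.left ≫ m.right.1 = v.map Y.hom.left := by
        rw [← liftsFunctor_obj_hom_left h.comm, ← liftsFunctor_obj_hom_left h.comm]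
        exact congrArg CostructuredArrow.Hom.left (StructuredArrow.w m)
      exact (v.map_comp _ φ.1).trans ((congrArg (_ ≫ ·) hv).trans hm)
    · have hX : u'.map X.hom.left ≫ eqToHom X.right.2 = Z.hom := CostructuredArrow.w X.hom
      have hY : u'.map Y.hom.left ≫ eqToHom Y.right.2 = Z.hom := CostructuredArrow.w Y.hom
      refine (u'.map_comp _ φ.1).trans ((congrArg (_ ≫ ·) (map_fiber_hom u' b φ)).trans ?_)
      refine (cancel_mono (eqToHom Y.right.2)).1 ?_
      exact (Category.assoc _ _ _).trans
        ((congrArg (_ ≫ ·) (eqToHom_trans _ _)).trans (hX.trans hY.symm))⟩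
  essSurj := ⟨fun Y => by
    obtain ⟨⟨x, hx⟩, Y, rfl⟩ := Y.mk_surjective
    obtain ⟨f, hf, rfl⟩ := CostructuredArrow.homMk_surjective Y
    obtain ⟨a, rfl, rfl⟩ := h.exists_obj x b hx
    obtain ⟨φ, h₁, h₂⟩ := h.exists_map (a₁ := Z.left) (a₂ := a) f Z.hom
      (hf.trans (congrArg (· ≫ w.map Z.hom) (eqToHom_app h.comm Z.left)))
    let a₀ : u'.Fiber (u'.obj a) := ⟨a, rfl⟩
    let X : StructuredArrow Z (fiberToOver u' (u'.obj a)) :=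
      StructuredArrow.mk (Y := a₀) (CostructuredArrow.homMk φ ((Category.comp_id _).trans h₂))
    exact ⟨X, ⟨StructuredArrow.isoMk (Iso.refl _) (CostructuredArrow.hom_ext _ _
      ((Category.comp_id _).trans ((liftsFunctor_obj_hom_left h.comm X).trans h₁)))⟩⟩⟩

/-- The comparison, for a strict pullback square, of the categories of lifts along `v` and `w`
of an arrow with given target. -/
abbrev coliftsFunctor (h : v ⋙ u = u' ⋙ w) {a : A} (Z : StructuredArrow a v) :
    CostructuredArrow (fiberToUnder v a) Z ⥤
      CostructuredArrow (fiberToUnder w (u.obj a))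
        (((TwoSquare.mk v u' u w (eqToHom h)).structuredArrowDownwards a).obj Z) :=
  CostructuredArrow.map₂ (F := fiberMap h.symm a) (fiberToUnderIso h a).inv (𝟙 _)

lemma coliftsFunctor_obj_hom_right (h : v ⋙ u = u' ⋙ w) {a : A} {Z : StructuredArrow a v}
    (X : CostructuredArrow (fiberToUnder v a) Z) :
    ((coliftsFunctor h Z).obj X).hom.right = u'.map X.hom.right :=
  (Category.id_comp _).trans (Category.comp_id _)

lemma isEquivalence_coliftsFunctor (h : IsStrictPullback v u' u w) {a : A}
    (Z : StructuredArrow a v) : (coliftsFunctor h.comm Z).IsEquivalence where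
  faithful := by
    have := h.symm.isEquivalence_fiberMap a
    infer_instance
  full := ⟨fun {X Y} m => by
    have := h.symm.isEquivalence_fiberMap a
    obtain ⟨φ, hφ⟩ := (fiberMap h.comm.symm a).map_surjective m.left
    refine ⟨CostructuredArrow.homMk φ ?_, CostructuredArrow.hom_ext _ _ hφ⟩
    refine StructuredArrow.hom_ext _ _ (h.hom_ext ?_ ?_)
    · have hX : eqToHom X.left.2.symm ≫ v.map X.hom.right = Z.hom := StructuredArrow.w X.hom
      have hY : eqToHom Y.left.2.symm ≫ v.map Y.hom.right = Z.hom := StructuredArrow.w Y.hom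
      refine (v.map_comp φ.1 _).trans ((congrArg (· ≫ _) (map_fiber_hom v a φ)).trans ?_)
      refine (cancel_epi (eqToHom X.left.2.symm)).1 ?_
      exact (Category.assoc _ _ _).symm.trans
        ((congrArg (· ≫ _) (eqToHom_trans _ _)).trans (hY.trans hX.symm))
    · have hu : u'.map φ.1 = m.left.1 := congrArg Subtype.val hφ
      have hm : m.left.1 ≫ u'.map Y.hom.right = u'.map X.hom.right :=
        (congrArg (m.left.1 ≫ ·) (coliftsFunctor_obj_hom_right h.comm Y)).symm.trans
          ((congrArg StructuredArrow.Hom.right (CostructuredArrow.w m)).trans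
            (coliftsFunctor_obj_hom_right h.comm X))
      exact (u'.map_comp φ.1 _).trans ((congrArg (· ≫ _) hu).trans hm)⟩
  essSurj := ⟨fun Y => by
    obtain ⟨⟨y, hy⟩, Y, rfl⟩ := Y.mk_surjective
    obtain ⟨g, hg, rfl⟩ := StructuredArrow.homMk_surjective Y
    obtain ⟨c, rfl, rfl⟩ := h.exists_obj a y hy.symm
    obtain ⟨φ, h₁, h₂⟩ := h.exists_map (a₁ := c) (a₂ := Z.right) Z.hom g
      ((congrArg (u.map Z.hom ≫ ·) (eqToHom_app h.comm Z.right)).symm.trans hg.symm)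
    let c₀ : v.Fiber (v.obj c) := ⟨c, rfl⟩
    let X : CostructuredArrow (fiberToUnder v (v.obj c)) Z :=
      CostructuredArrow.mk (Y := c₀) (StructuredArrow.homMk φ ((Category.id_comp _).trans h₁))
    exact ⟨X, ⟨CostructuredArrow.isoMk (Iso.refl _) (StructuredArrow.hom_ext _ _
      ((Category.id_comp _).trans (h₂.symm.trans
        (coliftsFunctor_obj_hom_right h.comm X).symm)))⟩⟩⟩

end IsStrictPullback

/-! ### Exactness of cartesian squares -/

namespace IsWeakFundamentalLocalizer

lemma isProper_of_isStrictPullback (hW : IsWeakFundamentalLocalizer W)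
    (h : IsStrictPullback v u' u w) (hu : IsProper W u) : IsProper W u' := fun _ =>
  (hW.isCoaspherical_iff _).2 fun Z =>
    have := h.isEquivalence_liftsFunctor Z
    (hW.asphericalCat_iff_of_equivalence (IsStrictPullback.liftsFunctor h.comm Z).asEquivalence).2
      ((hW.isCoaspherical_iff _).1 (hu _) _)

lemma isSmooth_of_isStrictPullback (hW : IsWeakFundamentalLocalizer W)
    (h : IsStrictPullback v u' u w) (hw : IsSmooth W w) : IsSmooth W v := fun _ =>
  (hW.isAspherical_iff _).2 fun Z =>
    have := h.isEquivalence_coliftsFunctor Z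
    (hW.asphericalCat_iff_of_equivalence
      (IsStrictPullback.coliftsFunctor h.comm Z).asEquivalence).2
      ((hW.isAspherical_iff _).1 (hw _) _)

lemma isExact_of_isProper (hW : IsWeakFundamentalLocalizer W) {α : TwoSquare v u' u w}
    (hα : IsCartesian α) (hu : IsProper W u) : IsExact W α := fun b => by
  have h := hα.isStrictPullback
  have := h.isEquivalence_fiberMap b
  rw [hα.eq_eqToHom]
  -- Cancellation along `A'_b ⥤ A'/b ⥤ A/w(b)`, whose composite is `A'_b ≌ A_{w(b)} ⥤ A/w(b)` up to
  -- isomorphism.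
  exact hW.isCoaspherical_of_comp (hW.isProper_of_isStrictPullback h hu b)
    (hW.isCoaspherical_of_iso (fiberToOverIso h.comm b).symm
      (hW.isCoaspherical_equivalence_comp _ (hu _)))

/-- For `g : u(a) ⟶ w(b)`, both conditions test the same category: objects `a'` with arrows `a ⟶
v(a')` and `u'(a') ⟶ b` which, through `α`, compose to `g`. -/
lemma isExact_iff (hW : IsWeakFundamentalLocalizer W) (α : TwoSquare v u' u w) :
    IsExact W α ↔ ∀ a, IsAspherical W (α.structuredArrowDownwards a) := by
  simp only [IsExact, hW.isAspherical_iff, hW.isCoaspherical_iff]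
  constructor
  · intro h a Z
    obtain ⟨b, g, rfl⟩ := Z.mk_surjective
    exact (hW.asphericalCat_iff_of_equivalence (α.equivalenceJ g)).1 (h b _)
  · intro h b Z
    obtain ⟨a, g, rfl⟩ := Z.mk_surjective
    exact (hW.asphericalCat_iff_of_equivalence (α.equivalenceJ g)).2 (h a _)

lemma isExact_of_isSmooth (hW : IsWeakFundamentalLocalizer W) {α : TwoSquare v u' u w}
    (hα : IsCartesian α) (hw : IsSmooth W w) : IsExact W α := by
  refine (hW.isExact_iff α).2 fun a => ?_
  have h := hα.isStrictPullback
  have := h.symm.isEquivalence_fiberMap a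
  rw [hα.eq_eqToHom]
  exact hW.isAspherical_of_comp (hW.isSmooth_of_isStrictPullback h hw a)
    (hW.isAspherical_of_iso (fiberToUnderIso h.comm a).symm
      (hW.isAspherical_equivalence_comp _ (hw _)))

end IsWeakFundamentalLocalizer

end BaseChange

/-! ### Fibres as pullbacks, and the converse -/

section FiberSquare

variable {W : MorphismProperty Cat.{s, s}} {A B : Type s} [SmallCategory A] [SmallCategory B]

/-- The commutative square expressing the fibre of `u` at `b` as a pullback. -/
def fiberSquare (u : A ⥤ B) (b : B) :
    TwoSquare (Functor.Fiber.fiberInclusion (p := u) (S := b)) (toPoint (u.Fiber b)) u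
      ((Functor.const (Discrete PUnit.{s + 1})).obj b) :=
  TwoSquare.mk _ _ _ _ (eqToHom Functor.Fiber.fiberInclusion_comp_eq_const)

lemma eq_inducedFunctor {C : Type s} [SmallCategory C] {u : A ⥤ B} {b : B} {F : C ⥤ A}
    (hF : F ⋙ u = (Functor.const C).obj b) (G : C ⥤ u.Fiber b)
    (hG : G ⋙ Functor.Fiber.fiberInclusion = F) : G = Functor.Fiber.inducedFunctor hF := by
  subst hG
  rfl

lemma isCartesian_fiberSquare (u : A ⥤ B) (b : B) : IsCartesian (fiberSquare u b) where
  comm := ⟨Functor.Fiber.fiberInclusion_comp_eq_const, rfl⟩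
  isPullback := by
    have comm : (Functor.Fiber.fiberInclusion (p := u) (S := b)).toCatHom ≫ u.toCatHom =
        (toPoint (u.Fiber b)).toCatHom ≫ ((Functor.const (Discrete PUnit)).obj b).toCatHom :=
      congrArg Functor.toCatHom
        (Functor.Fiber.fiberInclusion_comp_eq_const (p := u) (S := b))
    have hc (c : Limits.PullbackCone u.toCatHom
        ((Functor.const (Discrete PUnit.{s + 1})).obj b).toCatHom) :
        c.fst.toFunctor ⋙ u = (Functor.const c.pt).obj b :=
      congrArg (fun F => F.toFunctor) c.condition
    let L (c : Limits.PullbackCone u.toCatHom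
        ((Functor.const (Discrete PUnit.{s + 1})).obj b).toCatHom) :
        c.pt ⟶ Cat.of (u.Fiber b) :=
      Functor.toCatHom (D := u.Fiber b) (Functor.Fiber.inducedFunctor (hc c))
    exact ⟨⟨comm⟩, ⟨Limits.PullbackCone.IsLimit.mk _ L (fun _ => rfl) (fun _ => rfl)
      fun c m h _ => congrArg (Functor.toCatHom (D := u.Fiber b))
        (eq_inducedFunctor (hc c) m.toFunctor (congrArg (fun F => F.toFunctor) h))⟩⟩

/-- The identification of a category `C` with `C / *`, for its functor to the point. -/
@[simps]
def toPointOver (C : Type s) [SmallCategory C] :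
    C ⥤ CostructuredArrow (toPoint C) (⟨PUnit.unit⟩ : Discrete PUnit.{s + 1}) where
  obj x := CostructuredArrow.mk (Y := x) (𝟙 _)
  map φ := CostructuredArrow.homMk φ

instance (C : Type s) [SmallCategory C] : (toPointOver C).IsEquivalence where
  faithful := ⟨fun e => congrArg CostructuredArrow.Hom.left e⟩
  full := ⟨fun f => ⟨f.left, rfl⟩⟩
  essSurj := ⟨fun X => ⟨X.left, ⟨CostructuredArrow.isoMk (Iso.refl _)⟩⟩⟩

lemma IsWeakFundamentalLocalizer.isProper_of_isExact (hW : IsWeakFundamentalLocalizer W)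
    {u : A ⥤ B} (h : ∀ b, IsExact W (fiberSquare u b)) : IsProper W u := fun b => by
  -- Over the point, `A_b/*` is `A_b`, so the functor tested by exactness becomes `A_b ⥤ A/b`.
  let i : toPointOver (u.Fiber b) ⋙ (fiberSquare u b).costructuredArrowRightwards ⟨PUnit.unit⟩ ≅
      fiberToOver u b :=
    NatIso.ofComponents (fun x => CostructuredArrow.isoMk (Iso.refl _) (by
      have key : (eqToHom (Functor.Fiber.fiberInclusion_comp_eq_const (p := u) (S := b))).app x ≫
        𝟙 b = eqToHom x.2 := (Category.comp_id _).trans (eqToHom_app _ _)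
      exact (congrArg (· ≫ _) (u.map_id _)).trans ((Category.id_comp _).trans key.symm)))
      (fun f => CostructuredArrow.hom_ext _ _
        ((Category.comp_id _).trans (Category.id_comp _).symm))
  exact hW.isCoaspherical_of_iso i (hW.isCoaspherical_equivalence_comp _ (h b _))

end FiberSquare

end FundLoc

theorem mainTheorem6 (W : MorphismProperty Cat.{s, s})
    (hW : FundLoc.IsWeakFundamentalLocalizer W) :
    (∀ {A' A B' B : Type s} [SmallCategory A'] [SmallCategory A] [SmallCategory B']
        [SmallCategory B] (v : A' ⥤ A) (u' : A' ⥤ B') (u : A ⥤ B) (w : B' ⥤ B)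
        (α : TwoSquare v u' u w), FundLoc.IsCartesian α →
        (FundLoc.IsProper W u ∨ FundLoc.IsSmooth W w) → FundLoc.IsExact W α) ∧
    (∀ {A B : Type s} [SmallCategory A] [SmallCategory B] (u : A ⥤ B),
        FundLoc.IsProper W u ↔
          ∀ (A' B' : Type s) [SmallCategory A'] [SmallCategory B'] (v : A' ⥤ A)
            (u' : A' ⥤ B') (w : B' ⥤ B) (α : TwoSquare v u' u w),
            FundLoc.IsCartesian α → FundLoc.IsExact W α) :=
  ⟨fun _ _ _ _ _ hα h => h.elim (hW.isExact_of_isProper hα) (hW.isExact_of_isSmooth hα),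
    fun u => ⟨fun hu _ _ _ _ _ _ _ _ hα => hW.isExact_of_isProper hα hu,
      fun h => hW.isProper_of_isExact fun b =>
        h _ _ _ _ _ _ (FundLoc.isCartesian_fiberSquare u b)⟩⟩
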